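/- Let $(X_i,Y_i,T_i,U_i)$, $i\ge 1$, be i.i.d. random vectors in $\mathbb R^4$ such that the hidden vector $(X_i,Y_i)$, with distribution function $F_0$, is independent of the observation point $(T_i,U_i)$, with distribution function $G$. One observes $(T_i,U_i,\Delta_{i1},\Delta_{i2})$, $i=1,\dots,n$, where $\Delta_{i1}=1_{\{X_i\le T_i\}}$ and $\Delta_{i2}=1_{\{Y_i\le U_i\}}$. Let $\mathbb P_n$ be the empirical measure of these observations, and $\mathbb G_n$ the empirical measure of $(T_i,U_i)$, $i=1,\dots,n$. Let $(t,u)\in\mathbb R^2$ be such that $F_0$ and $G$ are twice continuously differentiable in a neighborhood of $(t,u)$, and such that the density $g=\partial_1\partial_2G$ (defined in that neighborhood) is differentiable at $(t,u)$ with $g(t,u)>0$. Let $h_n>0$ satisfy $\lim_{n\to\infty}h_n^2n^{1/3}=c>0$, let $A_n=[t-h_n,t+h_n]\times[u-h_n,u+h_n]$, and define $$\tilde F_n(t,u)=\frac{\int_{A_n}\delta_1\delta_2\,d\mathbb P_n(v,w,\delta_1,\delta_2)}{\int_{A_n}d\mathbb G_n(v,w)}$$ (with $0/0=0$). Then $$n^{1/3}\{\tilde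 F_n(t,u)-F_0(t,u)\}\stackrel{\mathcal D}{\longrightarrow}N(\beta,\sigma^2),$$ where $$\beta=c\left\{\tfrac16\left\{\partial_1^2F_0(t,u)+\partial_2^2F_0(t,u)\right\}+\frac{\partial_1F_0(t,u)\,\partial_1g(t,u)+\partial_2F_0(t,u)\,\partial_2g(t,u)}{3g(t,u)}\right\},\qquad \sigma^2=\frac{F_0(t,u)\{1-F_0(t,u)\}}{4c\,g(t,u)},$$ and $N(\beta,0)$ denotes the point mass at $\beta$. -/

import Mathlib

open MeasureTheory ProbabilityTheory Filter Topology
open scoped NNReal ENNReal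

noncomputable section

namespace BivariateCurrentStatus

/-- The joint distribution function `(v, w) ↦ P(V ≤ v, W ≤ w)` of a pair of real random
variables. -/
def jointCDF {Ω : Type*} [MeasurableSpace Ω] (P : Measure Ω) (V W : Ω → ℝ) : ℝ × ℝ → ℝ :=
  fun p => P.real {ω | V ω ≤ p.1 ∧ W ω ≤ p.2}

/-- First partial derivative of a function of two real variables. -/
def partial₁ (f : ℝ × ℝ → ℝ) : ℝ × ℝ → ℝ :=
  fun p => deriv (fun v => f (v, p.2)) p.1

/-- Second partial derivative (i.e. with respect to the second variable). -/
def partial₂ (f : ℝ × ℝ → ℝ) : ℝ × ℝ → ℝ :=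
  fun p => deriv (fun w => f (p.1, w)) p.2

/-- The density `∂₁∂₂ G` attached to a bivariate distribution function `G`, at points near which
`G` is twice continuously differentiable. -/
def densityOf (G : ℝ × ℝ → ℝ) : ℝ × ℝ → ℝ := partial₁ (partial₂ G)

/-- The closed square with midpoint `(t, u)` and half-width `h`. -/
def square (t u h : ℝ) : Set (ℝ × ℝ) :=
  Set.Icc (t - h) (t + h) ×ˢ Set.Icc (u - h) (u + h)

/-- The indicator of `{hidden ≤ observed}`, as a real number. -/
def status (x t : ℝ) : ℝ := if x ≤ t then 1 else 0

/-- The empirical measure (mass `1 / n` at each of the first `n` points) of a sequence of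
points `z 0, z 1, …`. -/
def empiricalMeasure {E : Type*} [MeasurableSpace E] (n : ℕ) (z : ℕ → E) : Measure E :=
  (n : ℝ≥0∞)⁻¹ • ∑ i ∈ Finset.range n, Measure.dirac (z i)

/-- The empirical measure `ℙₙ` of the observations `(Tᵢ, Uᵢ, Δᵢ₁, Δᵢ₂)`, where
`Δᵢ₁ = 1{Xᵢ ≤ Tᵢ}` and `Δᵢ₂ = 1{Yᵢ ≤ Uᵢ}`. -/
def empiricalP (n : ℕ) (x y t u : ℕ → ℝ) : Measure (ℝ × ℝ × ℝ × ℝ) :=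
  empiricalMeasure n fun i => (t i, u i, status (x i) (t i), status (y i) (u i))

/-- The empirical measure `𝔾ₙ` of the observation points `(Tᵢ, Uᵢ)`. -/
def empiricalG (n : ℕ) (t u : ℕ → ℝ) : Measure (ℝ × ℝ) :=
  empiricalMeasure n fun i => (t i, u i)

/-- The plug-in estimator `∫_A δ₁ δ₂ dℙₙ(v, w, δ₁, δ₂) / ∫_A d𝔾ₙ(v, w)`, where `A` is a set of
values of `(v, w)`. It is `0 / 0 = 0` when no observation point falls in `A`. -/
def plugInEstimator (n : ℕ) (x y t u : ℕ → ℝ) (A : Set (ℝ × ℝ)) : ℝ :=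
  (∫ p in {p : ℝ × ℝ × ℝ × ℝ | (p.1, p.2.1) ∈ A}, p.2.2.1 * p.2.2.2 ∂(empiricalP n x y t u)) /
    ∫ _p in A, (1 : ℝ) ∂(empiricalG n t u)

/-- The asymptotic mean
`c {(∂₁²F + ∂₂²F) / 6 + (∂₁F ∂₁g + ∂₂F ∂₂g) / (3 g)}`, evaluated at `p`. -/
def asymptoticMean (F g : ℝ × ℝ → ℝ) (c : ℝ) (p : ℝ × ℝ) : ℝ :=
  c * ((1 / 6) * (partial₁ (partial₁ F) p + partial₂ (partial₂ F) p) +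
    (partial₁ F p * partial₁ g p + partial₂ F p * partial₂ g p) / (3 * g p))

/-- The asymptotic variance `F (1 - F) / (4 c g)`, evaluated at `p`. -/
def asymptoticVariance (F g : ℝ × ℝ → ℝ) (c : ℝ) (p : ℝ × ℝ) : ℝ :=
  F p * (1 - F p) / (4 * c * g p)

end BivariateCurrentStatus

end

/-!
# Asymptotic normality of the local plug-in estimator

Multiplying by `n^(1/3)` turns the centred estimator into `Sₙ / Wₙ`. Here `Wₙ` is the number of
observation points in the square divided by `m = 4 n h² g(t, u)`, and `Sₙ` is `n^(1/3) / m` times the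
sum of `(Δ₁ Δ₂ - F₀(t, u)) 1{(T, U) ∈ square}`. Both are row sums of triangular arrays with i.i.d.
rows, bounded by a null sequence. For such arrays, the limits `n E ξ → β` and `n E ξ² → v` of the
first two moments imply convergence to `N(β, v)`, by expanding characteristic functions
(`tendstoInDistribution_sum_of_tendsto_moments`). For `Wₙ` the limit is `N(1, 0)`, so `Wₙ → 1` in
probability; for `Sₙ` it is the asserted normal law, and Slutsky's theorem
(`MeasureTheory.TendstoInDistribution.of_eq_div`) concludes. The event that the square contains no
observation point is `{Wₙ = 0}`, which has vanishing probability.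

The moments are integrals over the square. By independence of `(X, Y)` and `(T, U)` they become
integrals of `F₀` against the law of `(T, U)` (`integral_status_eq_setIntegral_jointCDF`), which has
density `g = ∂₁∂₂G` near `(t, u)` because its distribution function is of class `C²` there
(`eventually_setIntegral_square_eq`). Second moments and counts need only continuity. The bias
is the integral of `(F₀ - F₀(t, u)) g`, of order `h⁴`: in the second-order expansion of this product
(`exists_mul_sub_quadPoly_isLittleO`) the linear and mixed terms integrate to zero by symmetry, and
the two pure squares remain (`tendsto_integral_square_div_pow_four`).
-/

/-! ### A central limit theorem for bounded triangular arrays -/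

lemma norm_exp_mul_I_sub_taylor_two_le {x : ℝ} (hx : |x| ≤ 1) :
    ‖Complex.exp (x * Complex.I) - (1 + x * Complex.I - x ^ 2 / 2)‖ ≤ |x| ^ 3 := by
  have hn : ‖(x * Complex.I : ℂ)‖ = |x| := by simp
  have h := Complex.exp_bound (x := x * Complex.I) (by rw [hn]; exact hx) (n := 3) (by norm_num)
  rw [hn] at h
  have he : ∑ m ∈ Finset.range 3, ((x * Complex.I : ℂ)) ^ m / (m.factorial : ℂ)
      = 1 + x * Complex.I - x ^ 2 / 2 := by
    simp [Finset.sum_range_succ, mul_pow, Nat.factorial]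
    ring
  rw [he] at h
  refine h.trans ?_
  have : (0 : ℝ) ≤ |x| ^ 3 := by positivity
  norm_num [Nat.factorial]
  nlinarith

/-- The remainder of the second-order expansion of a characteristic function, for a bounded
variable: `|ξ|³ ≤ b ξ²` makes it small compared with the second moment. -/
lemma norm_charFun_map_sub_taylor_two_le {Ω : Type*} [MeasurableSpace Ω] {P : Measure Ω}
    [IsProbabilityMeasure P] {ξ : Ω → ℝ} (hm : Measurable ξ) {b : ℝ} (hb : ∀ ω, |ξ ω| ≤ b)
    {s : ℝ} (hs : |s| * b ≤ 1) :
    ‖charFun (P.map ξ) s - 1 - (s * (∫ ω, ξ ω ∂P : ℝ) * Complex.I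
      - s ^ 2 / 2 * (∫ ω, ξ ω ^ 2 ∂P : ℝ))‖ ≤ |s| ^ 3 * b * ∫ ω, ξ ω ^ 2 ∂P := by
  have hi1 : Integrable ξ P := .of_bound hm.aestronglyMeasurable b (ae_of_all _ fun ω => hb ω)
  have hi2 : Integrable (fun ω => ξ ω ^ 2) P := by
    refine .of_bound (by fun_prop) (b ^ 2) (ae_of_all _ fun ω => ?_)
    rw [Real.norm_eq_abs, abs_pow]
    exact pow_le_pow_left₀ (abs_nonneg _) (hb ω) 2
  have hie : Integrable (fun ω => Complex.exp ((s * ξ ω : ℝ) * Complex.I)) P := by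
    refine .of_bound (by fun_prop) 1 (ae_of_all _ fun ω => ?_)
    rw [Complex.norm_exp_ofReal_mul_I]
  have hi1c : Integrable (fun ω => s * (ξ ω : ℂ) * Complex.I) P :=
    (hi1.ofReal.const_mul _).mul_const _
  have hi2c : Integrable (fun ω => (s : ℂ) ^ 2 / 2 * ((ξ ω ^ 2 : ℝ) : ℂ)) P :=
    hi2.ofReal.const_mul _
  have key : charFun (P.map ξ) s - 1 - (s * (∫ ω, ξ ω ∂P : ℝ) * Complex.I
      - s ^ 2 / 2 * (∫ ω, ξ ω ^ 2 ∂P : ℝ)) =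
      ∫ ω, (Complex.exp ((s * ξ ω : ℝ) * Complex.I) - 1
        - (s * (ξ ω : ℂ) * Complex.I - s ^ 2 / 2 * ((ξ ω ^ 2 : ℝ) : ℂ))) ∂P := by
    rw [integral_sub, integral_sub, integral_sub hi1c hi2c, charFun_apply_real,
      integral_map hm.aemeasurable (by fun_prop), integral_mul_const, integral_const_mul,
      integral_const_mul, integral_complex_ofReal, integral_complex_ofReal]
    · simp
    · exact hie
    · exact integrable_const _
    · exact hie.sub (integrable_const _)
    · exact hi1c.sub hi2c
  rw [key, ← integral_const_mul]
  refine norm_integral_le_of_norm_le (hi2.const_mul _) (ae_of_all _ fun ω => ?_)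
  have hb0 : 0 ≤ b := (abs_nonneg _).trans (hb ω)
  have hx : |s * ξ ω| ≤ 1 := by
    rw [abs_mul]
    exact (mul_le_mul_of_nonneg_left (hb ω) (abs_nonneg s)).trans hs
  have h := norm_exp_mul_I_sub_taylor_two_le hx
  have e : Complex.exp ((s * ξ ω : ℝ) * Complex.I) - 1
        - (s * (ξ ω : ℂ) * Complex.I - s ^ 2 / 2 * ((ξ ω ^ 2 : ℝ) : ℂ))
      = Complex.exp ((s * ξ ω : ℝ) * Complex.I)
        - (1 + (s * ξ ω : ℝ) * Complex.I - ((s * ξ ω : ℝ) : ℂ) ^ 2 / 2) := by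
    push_cast; ring
  rw [e]
  refine h.trans ?_
  have : |s * ξ ω| ^ 3 = |s| ^ 3 * |ξ ω| * ξ ω ^ 2 := by
    rw [abs_mul, ← sq_abs (ξ ω)]; ring
  rw [this]
  gcongr
  exact hb ω

/-- A central limit theorem for triangular arrays with i.i.d. rows that are uniformly bounded by a
null sequence. Only the first two (non-centred) moments of the `n`-th row enter. The characteristic
function of the row sum is `(1 + zₙ) ^ n` with `n zₙ → i s β - s² v / 2`. -/
theorem tendstoInDistribution_sum_of_tendsto_moments {Ω : Type*} [MeasurableSpace Ω]
    {P : Measure Ω} [IsProbabilityMeasure P] {ξ : ℕ → ℕ → Ω → ℝ}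
    (hm : ∀ n i, Measurable (ξ n i)) (hindep : ∀ n, iIndepFun (ξ n) P)
    (hident : ∀ n i, IdentDistrib (ξ n i) (ξ n 0) P P)
    {b : ℕ → ℝ} (hb : ∀ n i ω, |ξ n i ω| ≤ b n) (hb0 : Tendsto b atTop (𝓝 0))
    {β v : ℝ} (h1 : Tendsto (fun n : ℕ => (n : ℝ) * ∫ ω, ξ n 0 ω ∂P) atTop (𝓝 β))
    (h2 : Tendsto (fun n : ℕ => (n : ℝ) * ∫ ω, ξ n 0 ω ^ 2 ∂P) atTop (𝓝 v)) :
    TendstoInDistribution (fun n ω => ∑ i ∈ Finset.range n, ξ n i ω) atTop (id : ℝ → ℝ)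
      (fun _ => P) (gaussianReal β v.toNNReal) where
  forall_aemeasurable n := (Finset.measurable_fun_sum _ fun i _ => hm n i).aemeasurable
  aemeasurable_limit := measurable_id.aemeasurable
  tendsto := by
    refine ProbabilityMeasure.tendsto_iff_tendsto_charFun.2 fun s => ?_
    have hv : 0 ≤ v := ge_of_tendsto' h2 fun n =>
      mul_nonneg n.cast_nonneg (integral_nonneg fun ω => sq_nonneg _)
    simp only [ProbabilityMeasure.coe_mk, Measure.map_id, charFun_gaussianReal]
    have hcf : ∀ n : ℕ, charFun (P.map fun ω => ∑ i ∈ Finset.range n, ξ n i ω) s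
        = (1 + (charFun (P.map (ξ n 0)) s - 1)) ^ n := by
      intro n
      rw [((hindep n).restrict _).charFun_map_fun_finsetSum_eq_prod
        (fun i _ => (hm n i).aemeasurable)]
      simp [fun i => (hident n i).map_eq]
    simp_rw [hcf]
    refine Complex.tendsto_one_add_pow_exp_of_tendsto ?_
    have hlim : Tendsto (fun n : ℕ => (s : ℂ) * (((n : ℝ) * ∫ ω, ξ n 0 ω ∂P : ℝ) : ℂ) * Complex.I
        - (s : ℂ) ^ 2 / 2 * (((n : ℝ) * ∫ ω, ξ n 0 ω ^ 2 ∂P : ℝ) : ℂ)) atTop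
        (𝓝 (s * β * Complex.I - (v.toNNReal : ℝ) * s ^ 2 / 2)) := by
      rw [Real.coe_toNNReal v hv]
      have e : (v : ℂ) * s ^ 2 / 2 = s ^ 2 / 2 * v := by ring
      rw [e]
      exact ((((Complex.continuous_ofReal.tendsto _).comp h1).const_mul _).mul_const _).sub
        (((Complex.continuous_ofReal.tendsto _).comp h2).const_mul _)
    have hsmall : Tendsto (fun n : ℕ => |s| ^ 3 * b n * ((n : ℝ) * ∫ ω, ξ n 0 ω ^ 2 ∂P)) atTop
        (𝓝 0) := by
      simpa using (hb0.const_mul (|s| ^ 3)).mul h2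
    have hdiff : Tendsto (fun n : ℕ => (n : ℂ) * (charFun (P.map (ξ n 0)) s - 1)
        - ((s : ℂ) * (((n : ℝ) * ∫ ω, ξ n 0 ω ∂P : ℝ) : ℂ) * Complex.I
          - (s : ℂ) ^ 2 / 2 * (((n : ℝ) * ∫ ω, ξ n 0 ω ^ 2 ∂P : ℝ) : ℂ))) atTop (𝓝 0) := by
      refine squeeze_zero_norm' ?_ hsmall
      have hev : ∀ᶠ n in atTop, |s| * b n < 1 :=
        (by simpa using hb0.const_mul |s| :
          Tendsto (fun n => |s| * b n) atTop (𝓝 0)).eventually_lt_const one_pos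
      filter_upwards [hev] with n hn
      have h := norm_charFun_map_sub_taylor_two_le (P := P) (hm n 0) (hb n 0) hn.le
      have e : (n : ℂ) * (charFun (P.map (ξ n 0)) s - 1)
        - ((s : ℂ) * (((n : ℝ) * ∫ ω, ξ n 0 ω ∂P : ℝ) : ℂ) * Complex.I
          - (s : ℂ) ^ 2 / 2 * (((n : ℝ) * ∫ ω, ξ n 0 ω ^ 2 ∂P : ℝ) : ℂ))
        = (n : ℂ) * (charFun (P.map (ξ n 0)) s - 1 - (s * (∫ ω, ξ n 0 ω ∂P : ℝ) * Complex.I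
      - s ^ 2 / 2 * (∫ ω, ξ n 0 ω ^ 2 ∂P : ℝ))) := by
        push_cast; ring
      rw [e, norm_mul, Complex.norm_natCast]
      calc _ ≤ (n : ℝ) * (|s| ^ 3 * b n * ∫ ω, ξ n 0 ω ^ 2 ∂P) := by gcongr
        _ = _ := by ring
    have := hdiff.add hlim
    simpa using this

/-! ### Convergence in probability to constants -/

/-- Convergence in distribution to a point mass is convergence in probability. -/
lemma tendstoInMeasure_of_tendstoInDistribution_dirac {Ω : Type*} [MeasurableSpace Ω]
    {P : Measure Ω} [IsProbabilityMeasure P] {W : ℕ → Ω → ℝ} {a : ℝ}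
    (h : TendstoInDistribution W atTop (id : ℝ → ℝ) (fun _ => P) (Measure.dirac a)) :
    TendstoInMeasure P W atTop (fun _ => a) := by
  rw [tendstoInMeasure_iff_dist]
  intro ε hε
  have hE : MeasurableSet {x : ℝ | ε ≤ dist x a} :=
    measurableSet_le measurable_const (by fun_prop)
  -- The frontier of the closed set is contained in a sphere, which does not contain `a`.
  have hfr : Measure.dirac a (frontier {x : ℝ | ε ≤ dist x a}) = 0 := by
    have hsub : frontier {x : ℝ | ε ≤ dist x a} ⊆ {x | ε = dist x a} :=
      frontier_le_subset_eq continuous_const (by fun_prop)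
    refine measure_mono_null hsub ?_
    rw [Measure.dirac_apply' _ (measurableSet_eq_fun measurable_const (by fun_prop))]
    simp [hε.ne']
  have := ProbabilityMeasure.tendsto_measure_of_null_frontier_of_tendsto' h.tendsto
    (E := {x : ℝ | ε ≤ dist x a}) (by simpa using hfr)
  simp only [ProbabilityMeasure.coe_mk, Measure.map_id] at this
  rw [Measure.dirac_apply' _ hE] at this
  simp only [Set.indicator, Set.mem_ofPred_eq, dist_self, not_le.2 hε, if_false] at this
  refine this.congr fun n => ?_
  rw [Measure.map_apply_of_aemeasurable (h.forall_aemeasurable n) hE]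
  rfl

/-- The continuous mapping theorem for convergence in probability to a constant. -/
lemma MeasureTheory.TendstoInMeasure.comp_continuousAt {Ω : Type*} [MeasurableSpace Ω]
    {P : Measure Ω} {W : ℕ → Ω → ℝ} {a : ℝ} (h : TendstoInMeasure P W atTop (fun _ => a))
    {f : ℝ → ℝ} (hf : ContinuousAt f a) :
    TendstoInMeasure P (fun n ω => f (W n ω)) atTop (fun _ => f a) := by
  rw [tendstoInMeasure_iff_dist] at h ⊢
  intro ε hε
  obtain ⟨δ, hδ, hfδ⟩ := Metric.continuousAt_iff.1 hf ε hε
  refine tendsto_of_tendsto_of_tendsto_of_le_of_le tendsto_const_nhds (h δ hδ)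
    (fun _ => zero_le) fun n => measure_mono fun ω hω => ?_
  by_contra hlt
  exact absurd (hfδ (not_le.1 hlt)) (not_lt.2 hω)

/-- Slutsky's theorem for ratios. If `Sₙ` converges in law and `Wₙ → 1` in probability, then any
`Zₙ` equal to `Sₙ / Wₙ` off `{Wₙ = 0}` has the same limit in law as `Sₙ`. -/
lemma MeasureTheory.TendstoInDistribution.of_eq_div {Ω Ω' : Type*}
    [MeasurableSpace Ω] [MeasurableSpace Ω'] {P : Measure Ω} [IsProbabilityMeasure P] {P' : Measure Ω'} [IsProbabilityMeasure P']
    {S W Z : ℕ → Ω → ℝ} {L : Ω' → ℝ}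
    (hS : TendstoInDistribution S atTop L (fun _ => P) P')
    (hW : TendstoInMeasure P W atTop (fun _ => 1))
    (hWm : ∀ n, Measurable (W n)) (hZm : ∀ n, Measurable (Z n))
    (hZ : ∀ᶠ n in atTop, ∀ ω, W n ω ≠ 0 → Z n ω = S n ω / W n ω) :
    TendstoInDistribution Z atTop L (fun _ => P) P' := by
  have hinv : TendstoInMeasure P (fun n ω => (W n ω)⁻¹) atTop (fun _ => 1) := by
    simpa using hW.comp_continuousAt (f := fun x => x⁻¹)
      (continuousAt_inv₀ one_ne_zero)
  have hSW : TendstoInDistribution (fun n ω => S n ω * (W n ω)⁻¹) atTop L (fun _ => P) P' := by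
    have := hS.continuous_comp_prodMk_of_tendstoInMeasure_const
      (g := fun x : ℝ × ℝ => x.1 * x.2) (by fun_prop) hinv
      (fun n => (hWm n).inv.aemeasurable)
    simpa using this
  refine tendstoInDistribution_of_tendstoInMeasure_sub Z L hSW ?_ (fun n => (hZm n).aemeasurable)
  rw [tendstoInMeasure_iff_dist] at hW ⊢
  intro ε hε
  refine tendsto_of_tendsto_of_tendsto_of_le_of_le' tendsto_const_nhds (hW 1 one_pos)
    (Eventually.of_forall fun _ => zero_le) ?_
  filter_upwards [hZ] with n hn
  refine measure_mono fun ω hω => ?_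
  by_cases h0 : W n ω = 0
  · simp [h0]
  · simp [hn ω h0, div_eq_mul_inv] at hω
    linarith

namespace BivariateCurrentStatus

/-! ### Second-order expansions and partial derivatives -/

/-- Taylor's formula of order two with Peano remainder, in any normed space. -/
lemma taylor_two_isLittleO {E : Type*} [NormedAddCommGroup E] [NormedSpace ℝ E] {f : E → ℝ}
    {p : E} (hf : ContDiffAt ℝ 2 f p) :
    (fun z => f z - f p - fderiv ℝ f p (z - p) - (1 / 2) * fderiv ℝ (fderiv ℝ f) p (z - p) (z - p))
      =o[𝓝 p] fun z => ‖z - p‖ ^ 2 := by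
  have hsymm : IsSymmSndFDerivAt ℝ f p := hf.isSymmSndFDerivAt (by simp)
  have hd : ∀ᶠ z in 𝓝 p, DifferentiableAt ℝ f z :=
    (hf.eventually (by simp)).mono fun z hz => hz.differentiableAt (by simp)
  have hdd : HasFDerivAt (fderiv ℝ f) (fderiv ℝ (fderiv ℝ f) p) p :=
    ((hf.fderiv_right (m := 1) (by norm_num)).differentiableAt (by simp)).hasFDerivAt
  set Q := fderiv ℝ (fderiv ℝ f) p
  rw [Asymptotics.isLittleO_iff]
  intro ε hε
  have hlo := (hasFDerivAt_iff_isLittleO.1 hdd).def hε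
  obtain ⟨r, hr, hball⟩ := Metric.eventually_nhds_iff_ball.1 (hd.and hlo)
  refine Metric.eventually_nhds_iff_ball.2 ⟨r, hr, fun z hz => ?_⟩
  -- The remainder vanishes at `p` and its derivative is `o(‖z - p‖)`, so the mean value
  -- inequality on the closed ball through `z` applies.
  have hder : ∀ y ∈ Metric.closedBall p ‖z - p‖, HasFDerivWithinAt
      (fun z => f z - f p - fderiv ℝ f p (z - p) - (1 / 2) * Q (z - p) (z - p))
      (fderiv ℝ f y - fderiv ℝ f p - Q (y - p)) (Metric.closedBall p ‖z - p‖) y := by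
    intro y hy
    have hyb : y ∈ Metric.ball p r := by
      rw [Metric.mem_ball]
      refine lt_of_le_of_lt (Metric.mem_closedBall.1 hy) ?_
      rwa [← dist_eq_norm]
    have h0 : HasFDerivAt (fun z : E => z - p) (ContinuousLinearMap.id ℝ E) y :=
      (hasFDerivAt_id y).sub_const p
    have h1 := (hball y hyb).1.hasFDerivAt
    have h2 : HasFDerivAt (fun z : E => fderiv ℝ f p (z - p)) (fderiv ℝ f p) y :=
      (fderiv ℝ f p).hasFDerivAt.comp y h0
    have h3 : HasFDerivAt (fun z : E => Q (z - p)) Q y := Q.hasFDerivAt.comp y h0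
    have h4 := (h3.clm_apply h0).const_mul (1 / 2 : ℝ)
    refine (((h1.sub_const (f p)).sub h2).sub h4).hasFDerivWithinAt.congr_fderiv ?_
    ext v
    have := hsymm.eq v (y - p)
    simp only [sub_apply, add_apply,
      smul_apply, ContinuousLinearMap.comp_apply, ContinuousLinearMap.coe_id',
      id, ContinuousLinearMap.flip_apply, smul_eq_mul]
    change _ - _ - (1 / 2) * (Q (y - p) v + Q v (y - p)) = _
    rw [show Q v (y - p) = Q (y - p) v from this]
    ring
  have hbound : ∀ y ∈ Metric.closedBall p ‖z - p‖,
      ‖fderiv ℝ f y - fderiv ℝ f p - Q (y - p)‖ ≤ ε * ‖z - p‖ := by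
    intro y hy
    have hyb : y ∈ Metric.ball p r := by
      rw [Metric.mem_ball]
      refine lt_of_le_of_lt (Metric.mem_closedBall.1 hy) ?_
      rwa [← dist_eq_norm]
    refine (hball y hyb).2.trans ?_
    gcongr
    simpa [dist_eq_norm] using hy
  have := (convex_closedBall p ‖z - p‖).norm_image_sub_le_of_norm_hasFDerivWithin_le hder hbound
    (x := p) (y := z) (by simp) (by simp [dist_eq_norm])
  simp only [sub_self, map_zero, mul_zero, sub_zero] at this
  rw [norm_pow, norm_norm]
  calc _ ≤ _ := this
    _ = _ := by ring

lemma partial₁_eq_fderiv {f : ℝ × ℝ → ℝ} {p : ℝ × ℝ} (hf : DifferentiableAt ℝ f p) :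
    partial₁ f p = fderiv ℝ f p (1, 0) := by
  have h : HasDerivAt (fun v : ℝ => (v, p.2)) ((1 : ℝ), (0 : ℝ)) p.1 :=
    (hasDerivAt_id p.1).prodMk (hasDerivAt_const _ _)
  exact (HasFDerivAt.comp_hasDerivAt (f := fun v : ℝ => (v, p.2)) p.1 hf.hasFDerivAt h).deriv

lemma partial₂_eq_fderiv {f : ℝ × ℝ → ℝ} {p : ℝ × ℝ} (hf : DifferentiableAt ℝ f p) :
    partial₂ f p = fderiv ℝ f p (0, 1) := by
  have h : HasDerivAt (fun w : ℝ => (p.1, w)) ((0 : ℝ), (1 : ℝ)) p.2 :=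
    (hasDerivAt_const _ _).prodMk (hasDerivAt_id p.2)
  exact (HasFDerivAt.comp_hasDerivAt (f := fun w : ℝ => (p.1, w)) p.2 hf.hasFDerivAt h).deriv

lemma partial₁_congr {f f' : ℝ × ℝ → ℝ} {p : ℝ × ℝ} (h : f =ᶠ[𝓝 p] f') :
    partial₁ f p = partial₁ f' p := by
  have hc : Tendsto (fun v : ℝ => (v, p.2)) (𝓝 p.1) (𝓝 p) :=
    (by fun_prop : Continuous fun v : ℝ => (v, p.2)).tendsto' _ _ rfl
  exact Filter.EventuallyEq.deriv_eq (hc.eventually h)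

lemma partial₂_congr {f f' : ℝ × ℝ → ℝ} {p : ℝ × ℝ} (h : f =ᶠ[𝓝 p] f') :
    partial₂ f p = partial₂ f' p := by
  have hc : Tendsto (fun w : ℝ => (p.1, w)) (𝓝 p.2) (𝓝 p) :=
    (by fun_prop : Continuous fun w : ℝ => (p.1, w)).tendsto' _ _ rfl
  exact Filter.EventuallyEq.deriv_eq (hc.eventually h)

lemma eventually_differentiableAt {f : ℝ × ℝ → ℝ} {p : ℝ × ℝ} (hf : ContDiffAt ℝ 2 f p) :
    ∀ᶠ q in 𝓝 p, DifferentiableAt ℝ f q :=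
  (hf.eventually (by simp)).mono fun _ hz => hz.differentiableAt (by simp)

lemma differentiableAt_fderiv {f : ℝ × ℝ → ℝ} {p : ℝ × ℝ} (hf : ContDiffAt ℝ 2 f p) :
    DifferentiableAt ℝ (fderiv ℝ f) p :=
  (hf.fderiv_right (m := 1) (by norm_num)).differentiableAt (by simp)

lemma fderiv_fderiv_apply {f : ℝ × ℝ → ℝ} {p : ℝ × ℝ} (hf : ContDiffAt ℝ 2 f p) (v w : ℝ × ℝ) :
    fderiv ℝ (fun q => fderiv ℝ f q v) p w = fderiv ℝ (fderiv ℝ f) p w v := by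
  rw [((differentiableAt_fderiv hf).hasFDerivAt.clm_apply (hasFDerivAt_const v p)).fderiv]
  simp

lemma partial₁_partial₁_eq {f : ℝ × ℝ → ℝ} {p : ℝ × ℝ} (hf : ContDiffAt ℝ 2 f p) :
    partial₁ (partial₁ f) p = fderiv ℝ (fderiv ℝ f) p (1, 0) (1, 0) := by
  rw [partial₁_congr ((eventually_differentiableAt hf).mono fun q hq => partial₁_eq_fderiv hq),
    partial₁_eq_fderiv ((differentiableAt_fderiv hf).clm_apply (differentiableAt_const _)),
    fderiv_fderiv_apply hf]

lemma partial₂_partial₂_eq {f : ℝ × ℝ → ℝ} {p : ℝ × ℝ} (hf : ContDiffAt ℝ 2 f p) :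
    partial₂ (partial₂ f) p = fderiv ℝ (fderiv ℝ f) p (0, 1) (0, 1) := by
  rw [partial₂_congr ((eventually_differentiableAt hf).mono fun q hq => partial₂_eq_fderiv hq),
    partial₂_eq_fderiv ((differentiableAt_fderiv hf).clm_apply (differentiableAt_const _)),
    fderiv_fderiv_apply hf]

lemma densityOf_eq {f : ℝ × ℝ → ℝ} {p : ℝ × ℝ} (hf : ContDiffAt ℝ 2 f p) :
    densityOf f p = fderiv ℝ (fderiv ℝ f) p (1, 0) (0, 1) := by
  rw [densityOf,
    partial₁_congr ((eventually_differentiableAt hf).mono fun q hq => partial₂_eq_fderiv hq),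
    partial₁_eq_fderiv ((differentiableAt_fderiv hf).clm_apply (differentiableAt_const _)),
    fderiv_fderiv_apply hf]

lemma continuousAt_densityOf {f : ℝ × ℝ → ℝ} {p : ℝ × ℝ} (hf : ContDiffAt ℝ 2 f p) :
    ContinuousAt (densityOf f) p := by
  have h0 : densityOf f =ᶠ[𝓝 p] fun q => fderiv ℝ (fderiv ℝ f) q (1, 0) (0, 1) :=
    (hf.eventually (by simp)).mono fun q hq => densityOf_eq hq
  have h1 : ContinuousAt (fderiv ℝ (fderiv ℝ f)) p :=
    ((hf.fderiv_right (m := 1) (by norm_num)).fderiv_right (m := 0) (by norm_num)).continuousAt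
  exact ((h1.clm_apply continuousAt_const).clm_apply continuousAt_const).congr h0.symm

lemma clm_apply_prod (L : ℝ × ℝ →L[ℝ] ℝ) (z : ℝ × ℝ) :
    L z = z.1 * L (1, 0) + z.2 * L (0, 1) := by
  conv_lhs => rw [show z = z.1 • ((1 : ℝ), (0 : ℝ)) + z.2 • ((0 : ℝ), (1 : ℝ)) by ext <;> simp]
  simp only [map_add, map_smul, smul_eq_mul]

/-- The polynomial `a x + b y + A x² + k x y + C y²` in the increment `(x, y) = z - p`.
The coefficient `k` of the mixed term plays no role for integrals over squares centred at `p`. -/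
def quadPoly (p : ℝ × ℝ) (a b A k C : ℝ) (z : ℝ × ℝ) : ℝ :=
  a * (z.1 - p.1) + b * (z.2 - p.2) + A * (z.1 - p.1) ^ 2 + k * ((z.1 - p.1) * (z.2 - p.2))
    + C * (z.2 - p.2) ^ 2

lemma exists_sub_quadPoly_isLittleO {f : ℝ × ℝ → ℝ} {p : ℝ × ℝ} (hf : ContDiffAt ℝ 2 f p) :
    ∃ k, (fun z => f z - f p - quadPoly p (partial₁ f p) (partial₂ f p)
      (partial₁ (partial₁ f) p / 2) k (partial₂ (partial₂ f) p / 2) z)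
      =o[𝓝 p] fun z => ‖z - p‖ ^ 2 := by
  refine ⟨(fderiv ℝ (fderiv ℝ f) p (1, 0) (0, 1) + fderiv ℝ (fderiv ℝ f) p (0, 1) (1, 0)) / 2, ?_⟩
  refine (taylor_two_isLittleO hf).congr_left fun z => ?_
  have h1 : fderiv ℝ (fderiv ℝ f) p (z - p)
      = (z - p).1 • fderiv ℝ (fderiv ℝ f) p (1, 0) + (z - p).2 • fderiv ℝ (fderiv ℝ f) p (0, 1) := by
    conv_lhs => rw [show z - p = (z - p).1 • ((1 : ℝ), (0 : ℝ)) + (z - p).2 • ((0 : ℝ), (1 : ℝ)) by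
      ext <;> simp]
    simp only [map_add, map_smul]
  rw [h1, partial₁_eq_fderiv (hf.differentiableAt (by simp)),
    partial₂_eq_fderiv (hf.differentiableAt (by simp)), partial₁_partial₁_eq hf,
    partial₂_partial₂_eq hf, clm_apply_prod (fderiv ℝ f p) (z - p)]
  simp only [add_apply, smul_apply, smul_eq_mul]
  rw [clm_apply_prod (fderiv ℝ (fderiv ℝ f) p (1, 0)) (z - p),
    clm_apply_prod (fderiv ℝ (fderiv ℝ f) p (0, 1)) (z - p)]
  simp only [quadPoly, Prod.fst_sub, Prod.snd_sub]
  ring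

/-- Expansion of `(f - f p) g` up to second order: only the first-order expansion of `g` is
needed, because `f - f p` is already of first order. -/
lemma exists_mul_sub_quadPoly_isLittleO {f g : ℝ × ℝ → ℝ} {p : ℝ × ℝ} (hf : ContDiffAt ℝ 2 f p)
    (hg : DifferentiableAt ℝ g p) :
    ∃ k, (fun z => (f z - f p) * g z - quadPoly p (partial₁ f p * g p) (partial₂ f p * g p)
      (partial₁ (partial₁ f) p / 2 * g p + partial₁ f p * partial₁ g p) k
      (partial₂ (partial₂ f) p / 2 * g p + partial₂ f p * partial₂ g p) z)
      =o[𝓝 p] fun z => ‖z - p‖ ^ 2 := by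
  obtain ⟨k, hk⟩ := exists_sub_quadPoly_isLittleO hf
  refine ⟨k * g p + partial₁ f p * partial₂ g p + partial₂ f p * partial₁ g p, ?_⟩
  have hg1 := hasFDerivAt_iff_isLittleO.1 hg.hasFDerivAt
  have hgO : (fun z => g z - g p) =O[𝓝 p] fun z => z - p := hg.isBigO_sub
  have hfO : (fun z => f z - f p) =O[𝓝 p] fun z => ‖z - p‖ :=
    (hf.differentiableAt (by simp)).isBigO_sub.norm_right
  have hx : (fun z : ℝ × ℝ => z.1 - p.1) =O[𝓝 p] fun z => ‖z - p‖ :=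
    .of_bound 1 (Eventually.of_forall fun z => by
      simpa using norm_fst_le (z - p))
  have hy : (fun z : ℝ × ℝ => z.2 - p.2) =O[𝓝 p] fun z => ‖z - p‖ :=
    .of_bound 1 (Eventually.of_forall fun z => by
      simpa using norm_snd_le (z - p))
  have hlin : (fun z => g z - g p - fderiv ℝ g p (z - p)) =o[𝓝 p] fun z => ‖z - p‖ :=
    hg1.norm_right
  have hflin : (fun z => f z - f p - (partial₁ f p * (z.1 - p.1) + partial₂ f p * (z.2 - p.2)))
      =o[𝓝 p] fun z => ‖z - p‖ := by
    refine (hasFDerivAt_iff_isLittleO.1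
      (hf.differentiableAt (by simp)).hasFDerivAt).norm_right.congr_left fun z => ?_
    rw [clm_apply_prod (fderiv ℝ f p), partial₁_eq_fderiv (hf.differentiableAt (by simp)),
      partial₂_eq_fderiv (hf.differentiableAt (by simp)), Prod.fst_sub, Prod.snd_sub]
    ring
  have hl : (fun z => fderiv ℝ g p (z - p)) =O[𝓝 p] fun z => ‖z - p‖ :=
    ((fderiv ℝ g p).isBigO_sub _ _).norm_right |>.congr_left fun z => by simp
  -- The error is `(f - f p) (g - g p - Dg) + (f - f p - Df) Dg + g p * (Taylor remainder of f)`.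
  have e1 := hfO.mul_isLittleO hlin
  have e2 := hflin.mul_isBigO hl
  have e3 := hk.const_mul_left (g p)
  have hsum := ((e1.congr_right fun z => (pow_two _).symm).add
    (e2.congr_right fun z => (pow_two _).symm)).add e3
  refine hsum.congr_left fun z => ?_
  rw [clm_apply_prod (fderiv ℝ g p) (z - p), ← partial₁_eq_fderiv hg, ← partial₂_eq_fderiv hg]
  simp only [quadPoly, Prod.fst_sub, Prod.snd_sub]
  ring

/-! ### Integrals over shrinking squares -/

lemma square_eq_closedBall (t u : ℝ) (h : ℝ) :
    square t u h = Metric.closedBall (t, u) h := by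
  rw [square, ← closedBall_prod_same, Real.closedBall_eq_Icc, Real.closedBall_eq_Icc]

lemma measurableSet_square (t u h : ℝ) : MeasurableSet (square t u h) :=
  measurableSet_Icc.prod measurableSet_Icc

lemma isCompact_square (t u h : ℝ) : IsCompact (square t u h) :=
  isCompact_Icc.prod isCompact_Icc

lemma volume_real_square (t u : ℝ) {h : ℝ} (hh : 0 ≤ h) :
    (volume : Measure (ℝ × ℝ)).real (square t u h) = 4 * h ^ 2 := by
  rw [square, Measure.volume_eq_prod, measureReal_prod_prod, Real.volume_real_Icc_of_le (by linarith),
    Real.volume_real_Icc_of_le (by linarith)]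
  ring

lemma eventually_forall_mem_square {t u : ℝ} {Q : ℝ × ℝ → Prop} (hQ : ∀ᶠ z in 𝓝 (t, u), Q z) :
    ∀ᶠ h in 𝓝[>] (0 : ℝ), ∀ z ∈ square t u h, Q z := by
  obtain ⟨r, hr, hball⟩ := Metric.eventually_nhds_iff_ball.1 hQ
  filter_upwards [Ioo_mem_nhdsGT hr] with h hh z hz
  rw [square_eq_closedBall] at hz
  exact hball z (Metric.closedBall_subset_ball hh.2 hz)

lemma integral_Icc_sub_pow (t h : ℝ) (hh : 0 ≤ h) (k : ℕ) :
    ∫ x in Set.Icc (t - h) (t + h), (x - t) ^ k = (h ^ (k + 1) - (-h) ^ (k + 1)) / (k + 1) := by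
  rw [integral_Icc_eq_integral_Ioc, ← intervalIntegral.integral_of_le (by linarith),
    intervalIntegral.integral_comp_sub_right (fun x => x ^ k), integral_pow]
  congr 3 <;> ring

lemma integral_square_monomial (t u : ℝ) {h : ℝ} (hh : 0 ≤ h) (k l : ℕ) :
    ∫ z in square t u h, (z.1 - t) ^ k * (z.2 - u) ^ l
      = (h ^ (k + 1) - (-h) ^ (k + 1)) / (k + 1) * ((h ^ (l + 1) - (-h) ^ (l + 1)) / (l + 1)) := by
  rw [← integral_Icc_sub_pow t h hh, ← integral_Icc_sub_pow u h hh, square,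
    Measure.volume_eq_prod]
  exact setIntegral_prod_mul (fun x => (x - t) ^ k) (fun y => (y - u) ^ l) _ _

lemma integral_square_quadPoly (t u : ℝ) {h : ℝ} (hh : 0 ≤ h) (a b A k C : ℝ) :
    ∫ z in square t u h, quadPoly (t, u) a b A k C z = 4 * (A + C) / 3 * h ^ 4 := by
  have hi : ∀ m l : ℕ, IntegrableOn (fun z : ℝ × ℝ => (z.1 - t) ^ m * (z.2 - u) ^ l)
      (square t u h) := fun m l =>
    (by fun_prop : Continuous fun z : ℝ × ℝ => (z.1 - t) ^ m * (z.2 - u) ^ l).continuousOn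
      |>.integrableOn_compact (isCompact_square t u h)
  have e : ∀ z : ℝ × ℝ, quadPoly (t, u) a b A k C z =
      a * ((z.1 - t) ^ 1 * (z.2 - u) ^ 0) + b * ((z.1 - t) ^ 0 * (z.2 - u) ^ 1)
      + A * ((z.1 - t) ^ 2 * (z.2 - u) ^ 0) + k * ((z.1 - t) ^ 1 * (z.2 - u) ^ 1)
      + C * ((z.1 - t) ^ 0 * (z.2 - u) ^ 2) := fun z => by simp only [quadPoly]; ring
  simp_rw [e]
  have i1 := (hi 1 0).const_mul a
  have i2 := (hi 0 1).const_mul b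
  have i3 := (hi 2 0).const_mul A
  have i4 := (hi 1 1).const_mul k
  have i5 := (hi 0 2).const_mul C
  rw [integral_add (((i1.fun_add i2).fun_add i3).fun_add i4) i5,
    integral_add ((i1.fun_add i2).fun_add i3) i4, integral_add (i1.fun_add i2) i3, integral_add i1 i2]
  simp only [integral_const_mul, integral_square_monomial t u hh]
  norm_num
  ring

lemma tendsto_integral_square_of_isLittleO {t u : ℝ} {r : ℝ × ℝ → ℝ} (k : ℕ)
    (hr : r =o[𝓝 (t, u)] fun z => ‖z - (t, u)‖ ^ k) :
    Tendsto (fun h => (∫ z in square t u h, r z) / h ^ (k + 2)) (𝓝[>] 0) (𝓝 0) := by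
  rw [Metric.tendsto_nhds]
  intro ε hε
  have hε' : 0 < ε / 5 := by positivity
  filter_upwards [eventually_forall_mem_square (hr.def hε'), self_mem_nhdsWithin] with h hz h0
  have h0' : (0 : ℝ) < h := h0
  have hb : ∀ z ∈ square t u h, ‖r z‖ ≤ ε / 5 * h ^ k := by
    intro z hzm
    refine (hz z hzm).trans ?_
    rw [square_eq_closedBall, Metric.mem_closedBall, dist_eq_norm] at hzm
    rw [norm_pow, norm_norm]
    gcongr
  have := norm_setIntegral_le_of_norm_le_const (μ := volume)
    (isCompact_square t u h).measure_lt_top hb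
  rw [volume_real_square t u h0'.le] at this
  rw [dist_zero_right, norm_div, norm_pow, Real.norm_of_nonneg h0'.le, div_lt_iff₀ (by positivity)]
  calc _ ≤ _ := this
    _ = 4 / 5 * (ε * h ^ (k + 2)) := by ring
    _ < _ := by
      have : 0 < ε * h ^ (k + 2) := by positivity
      linarith

lemma eventually_integrableOn_square {t u : ℝ} {f : ℝ × ℝ → ℝ}
    (hf : ∀ᶠ z in 𝓝 (t, u), ContinuousAt f z) :
    ∀ᶠ h in 𝓝[>] (0 : ℝ), IntegrableOn f (square t u h) :=
  (eventually_forall_mem_square hf).mono fun h hh =>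
    ContinuousOn.integrableOn_compact (isCompact_square t u h)
      fun z hz => (hh z hz).continuousWithinAt

/-- The integral of a function over the square of half-width `h`, of area `4 h²`, is to leading
order `4 h²` times its value at the midpoint. -/
lemma tendsto_integral_square_div_sq {t u : ℝ} {f : ℝ × ℝ → ℝ}
    (hf : ∀ᶠ z in 𝓝 (t, u), ContinuousAt f z) :
    Tendsto (fun h => (∫ z in square t u h, f z) / h ^ 2) (𝓝[>] 0) (𝓝 (4 * f (t, u))) := by
  have hr : (fun z => f z - f (t, u)) =o[𝓝 (t, u)] fun z => ‖z - (t, u)‖ ^ 0 := by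
    simp only [pow_zero]
    rw [Asymptotics.isLittleO_one_iff]
    simpa using hf.self_of_nhds.tendsto.sub_const (f (t, u))
  have h0 := (tendsto_integral_square_of_isLittleO 0 hr).add_const (4 * f (t, u))
  rw [zero_add (4 * f (t, u))] at h0
  refine h0.congr' ?_
  filter_upwards [eventually_integrableOn_square hf, self_mem_nhdsWithin] with h hi hpos
  have hpos' : (0 : ℝ) < h := hpos
  rw [integral_sub hi (integrableOn_const (isCompact_square t u h).measure_ne_top),
    setIntegral_const, volume_real_square t u hpos'.le]
  simp only [smul_eq_mul]
  field_simp
  ring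

/-- For a function without constant term, the integral over the square of half-width `h` is of
order `h⁴`; only the coefficients of the pure squares survive by symmetry. -/
lemma tendsto_integral_square_div_pow_four {t u : ℝ} {f : ℝ × ℝ → ℝ} {a b A k C : ℝ}
    (hf : ∀ᶠ z in 𝓝 (t, u), ContinuousAt f z)
    (hr : (fun z => f z - quadPoly (t, u) a b A k C z) =o[𝓝 (t, u)] fun z => ‖z - (t, u)‖ ^ 2) :
    Tendsto (fun h => (∫ z in square t u h, f z) / h ^ 4) (𝓝[>] 0) (𝓝 (4 * (A + C) / 3)) := by
  have h0 := (tendsto_integral_square_of_isLittleO 2 hr).add_const (4 * (A + C) / 3)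
  rw [zero_add] at h0
  refine h0.congr' ?_
  filter_upwards [eventually_integrableOn_square hf, self_mem_nhdsWithin] with h hi hpos
  have hpos' : (0 : ℝ) < h := hpos
  have hq : IntegrableOn (quadPoly (t, u) a b A k C) (square t u h) :=
    (by unfold quadPoly; fun_prop : Continuous (quadPoly (t, u) a b A k C)).continuousOn
      |>.integrableOn_compact (isCompact_square t u h)
  rw [integral_sub hi hq, integral_square_quadPoly t u hpos'.le]
  field_simp
  ring

/-! ### The law of a pair with smooth distribution function -/

lemma measureReal_Ioc_prod_Ioc (μ : Measure (ℝ × ℝ)) [IsFiniteMeasure μ] {a b c d : ℝ}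
    (hab : a ≤ b) (hcd : c ≤ d) :
    μ.real (Set.Ioc a b ×ˢ Set.Ioc c d)
      = μ.real (Set.Iic b ×ˢ Set.Iic d) - μ.real (Set.Iic a ×ˢ Set.Iic d)
        - (μ.real (Set.Iic b ×ˢ Set.Iic c) - μ.real (Set.Iic a ×ˢ Set.Iic c)) := by
  have h1 : ∀ y : ℝ, μ.real (Set.Ioc a b ×ˢ Set.Iic y)
      = μ.real (Set.Iic b ×ˢ Set.Iic y) - μ.real (Set.Iic a ×ˢ Set.Iic y) := by
    intro y
    rw [← measureReal_sdiff (Set.prod_mono_left (Set.Iic_subset_Iic.2 hab))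
      (measurableSet_Iic.prod measurableSet_Iic)]
    congr 1
    ext z
    simp only [Set.mem_prod, Set.mem_Ioc, Set.mem_Iic, Set.mem_sdiff]
    constructor
    · rintro ⟨⟨h1, h2⟩, h3⟩; exact ⟨⟨h2, h3⟩, fun h => absurd h.1 (not_le.2 h1)⟩
    · rintro ⟨⟨h2, h3⟩, h⟩; exact ⟨⟨not_le.1 fun h1 => h ⟨h1, h3⟩, h2⟩, h3⟩
  rw [← h1, ← h1, ← measureReal_sdiff (Set.prod_mono_right (Set.Iic_subset_Iic.2 hcd))
      (measurableSet_Ioc.prod measurableSet_Iic)]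
  congr 1
  ext z
  simp only [Set.mem_prod, Set.mem_Ioc, Set.mem_Iic, Set.mem_sdiff]
  constructor
  · rintro ⟨h3, ⟨h1, h2⟩⟩; exact ⟨⟨h3, h2⟩, fun h => absurd h.2 (not_le.2 h1)⟩
  · rintro ⟨⟨h3, h2⟩, h⟩; exact ⟨h3, ⟨not_le.1 fun h1 => h ⟨h3, h1⟩, h2⟩⟩

/-- The mixed increment of `G` over a rectangle is the integral of `∂₁∂₂ G`. -/
lemma increment_eq_integral_densityOf {G : ℝ × ℝ → ℝ} {a b c d : ℝ} (hab : a ≤ b) (hcd : c ≤ d)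
    (hG : ∀ z ∈ Set.Icc a b ×ˢ Set.Icc c d, ContDiffAt ℝ 2 G z) :
    G (b, d) - G (a, d) - (G (b, c) - G (a, c))
      = ∫ z in Set.Ioc a b ×ˢ Set.Ioc c d, densityOf G z := by
  have hcont : ContinuousOn (densityOf G) (Set.Icc a b ×ˢ Set.Icc c d) := fun z hz =>
    (continuousAt_densityOf (hG z hz)).continuousWithinAt
  have hd2 : ∀ v ∈ Set.Icc a b, ∀ w ∈ Set.Icc c d,
      HasDerivAt (fun w => G (v, w)) (partial₂ G (v, w)) w := by
    intro v hv w hw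
    have hdiff : DifferentiableAt ℝ G (v, w) := (hG (v, w) ⟨hv, hw⟩).differentiableAt (by simp)
    exact (hdiff.comp w (f := fun w : ℝ => (v, w)) (by fun_prop)).hasDerivAt
  have hd1 : ∀ v ∈ Set.Icc a b, ∀ w ∈ Set.Icc c d,
      HasDerivAt (fun v => partial₂ G (v, w)) (densityOf G (v, w)) v := by
    intro v hv w hw
    have hz := hG (v, w) ⟨hv, hw⟩
    have hdiff : DifferentiableAt ℝ (partial₂ G) (v, w) :=
      ((differentiableAt_fderiv hz).clm_apply (differentiableAt_const _)).congr_of_eventuallyEq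
        ((eventually_differentiableAt hz).mono fun q hq => partial₂_eq_fderiv hq)
    exact (hdiff.comp v (f := fun v : ℝ => (v, w)) (by fun_prop)).hasDerivAt
  have hc2 : ContinuousOn (partial₂ G) (Set.Icc a b ×ˢ Set.Icc c d) := by
    intro z hz
    have hz := hG z hz
    exact (((differentiableAt_fderiv hz).clm_apply
      (differentiableAt_const _)).congr_of_eventuallyEq
        ((eventually_differentiableAt hz).mono fun q hq =>
          partial₂_eq_fderiv hq)).continuousAt.continuousWithinAt
  have hline : ∀ v ∈ Set.Icc a b, ContinuousOn (fun w => partial₂ G (v, w)) (Set.Icc c d) :=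
    fun v hv => hc2.comp (by fun_prop) fun w hw => ⟨hv, hw⟩
  have hinner : ∀ w ∈ Set.Icc c d,
      ∫ v in a..b, densityOf G (v, w) = partial₂ G (b, w) - partial₂ G (a, w) := by
    intro w hw
    refine intervalIntegral.integral_eq_sub_of_hasDerivAt
      (f := fun v => partial₂ G (v, w)) (fun v hv => ?_) ?_
    · rw [Set.uIcc_of_le hab] at hv
      exact hd1 v hv w hw
    · refine ContinuousOn.intervalIntegrable ?_
      rw [Set.uIcc_of_le hab]
      exact hcont.comp (by fun_prop) fun v hv => ⟨hv, hw⟩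
  have hint : IntegrableOn (densityOf G) (Set.Ioc a b ×ˢ Set.Ioc c d) :=
    (hcont.integrableOn_compact (isCompact_Icc.prod isCompact_Icc)).mono_set
      (Set.prod_mono Set.Ioc_subset_Icc_self Set.Ioc_subset_Icc_self)
  have houter : ∫ w in c..d, (partial₂ G (b, w) - partial₂ G (a, w))
      = G (b, d) - G (a, d) - (G (b, c) - G (a, c)) := by
    refine intervalIntegral.integral_eq_sub_of_hasDerivAt
      (f := fun w => G (b, w) - G (a, w)) (fun w hw => ?_) ?_
    · rw [Set.uIcc_of_le hcd] at hw
      exact (hd2 b (Set.right_mem_Icc.2 hab) w hw).sub (hd2 a (Set.left_mem_Icc.2 hab) w hw)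
    · refine ContinuousOn.intervalIntegrable ?_
      rw [Set.uIcc_of_le hcd]
      exact (hline b (Set.right_mem_Icc.2 hab)).sub (hline a (Set.left_mem_Icc.2 hab))
  rw [← houter, intervalIntegral.integral_of_le hcd, Measure.volume_eq_prod,
    ← Measure.prod_restrict, integral_prod_symm]
  · refine setIntegral_congr_fun measurableSet_Ioc fun w hw => ?_
    rw [← hinner w (Set.Ioc_subset_Icc_self hw), intervalIntegral.integral_of_le hab]
  · rw [Measure.prod_restrict, ← Measure.volume_eq_prod]
    exact hint

/-- A finite measure on the plane is determined by its distribution function and its total mass. -/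
lemma ext_of_Iic_prod_Iic {μ ν : Measure (ℝ × ℝ)} [IsFiniteMeasure μ]
    (h : ∀ x y, μ (Set.Iic x ×ˢ Set.Iic y) = ν (Set.Iic x ×ˢ Set.Iic y))
    (huniv : μ Set.univ = ν Set.univ) : μ = ν := by
  have hspan : IsCountablySpanning (Set.range (Set.Iic : ℝ → Set ℝ)) :=
    ⟨fun n : ℕ => Set.Iic (n : ℝ), fun n => ⟨n, rfl⟩, by
      ext x
      simpa using exists_nat_ge x⟩
  have hgen : (inferInstance : MeasurableSpace ℝ)
      = MeasurableSpace.generateFrom (Set.range Set.Iic) :=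
    (BorelSpace.measurable_eq (α := ℝ)).trans (borel_eq_generateFrom_Iic ℝ)
  refine ext_of_generate_finite _ (generateFrom_eq_prod hgen.symm hgen.symm hspan hspan).symm
    (isPiSystem_Iic.prod isPiSystem_Iic) ?_ huniv
  rintro _ ⟨_, ⟨x, rfl⟩, _, ⟨y, rfl⟩, rfl⟩
  exact h x y

/-- On a half-open rectangle where the distribution function of `μ` is of class `C²` with
nonnegative mixed derivative, that mixed derivative is a density of `μ`. -/
lemma restrict_eq_withDensity_densityOf {μ : Measure (ℝ × ℝ)} [IsFiniteMeasure μ]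
    {G : ℝ × ℝ → ℝ} (hμ : ∀ q, G q = μ.real (Set.Iic q.1 ×ˢ Set.Iic q.2)) {a b c d : ℝ}
    (hG : ∀ z ∈ Set.Icc a b ×ˢ Set.Icc c d, ContDiffAt ℝ 2 G z)
    (hpos : ∀ z ∈ Set.Icc a b ×ˢ Set.Icc c d, 0 ≤ densityOf G z) :
    μ.restrict (Set.Ioc a b ×ˢ Set.Ioc c d) =
      (volume.restrict (Set.Ioc a b ×ˢ Set.Ioc c d)).withDensity
        fun z => ENNReal.ofReal (densityOf G z) := by
  have hcont : ContinuousOn (densityOf G) (Set.Icc a b ×ˢ Set.Icc c d) := fun z hz =>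
    (continuousAt_densityOf (hG z hz)).continuousWithinAt
  have hK : MeasurableSet (Set.Ioc a b ×ˢ Set.Ioc c d) := measurableSet_Ioc.prod measurableSet_Ioc
  have key : ∀ b' d', b' ≤ b → d' ≤ d → μ (Set.Ioc a b' ×ˢ Set.Ioc c d')
      = ∫⁻ z in Set.Ioc a b' ×ˢ Set.Ioc c d', ENNReal.ofReal (densityOf G z) := by
    intro b' d' hb hd
    -- If `b' < a` or `d' < c`, the rectangle is empty.
    rcases lt_or_ge b' a with h1 | h1
    · simp [Set.Ioc_eq_empty_of_le h1.le]
    rcases lt_or_ge d' c with h2 | h2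
    · simp [Set.Ioc_eq_empty_of_le h2.le]
    have hsub : Set.Icc a b' ×ˢ Set.Icc c d' ⊆ Set.Icc a b ×ˢ Set.Icc c d :=
      Set.prod_mono (Set.Icc_subset_Icc_right hb) (Set.Icc_subset_Icc_right hd)
    have hsub' : Set.Ioc a b' ×ˢ Set.Ioc c d' ⊆ Set.Icc a b' ×ˢ Set.Icc c d' :=
      Set.prod_mono Set.Ioc_subset_Icc_self Set.Ioc_subset_Icc_self
    rw [← ofReal_integral_eq_lintegral_ofReal, ← increment_eq_integral_densityOf h1 h2
      fun z hz => hG z (hsub hz)]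
    · rw [hμ, hμ, hμ, hμ, ← measureReal_Ioc_prod_Ioc μ h1 h2, ofReal_measureReal]
    · exact ((hcont.mono hsub).integrableOn_compact (isCompact_Icc.prod isCompact_Icc)).mono_set
        hsub'
    · exact (ae_restrict_iff' (measurableSet_Ioc.prod measurableSet_Ioc)).2
        (ae_of_all _ fun z hz => hpos z (hsub (hsub' hz)))
  refine ext_of_Iic_prod_Iic (fun x y => ?_) ?_
  · have hm : MeasurableSet (Set.Iic x ×ˢ Set.Iic y) := measurableSet_Iic.prod measurableSet_Iic
    rw [Measure.restrict_apply hm, withDensity_apply _ hm, Measure.restrict_restrict hm,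
      Set.prod_inter_prod, Set.inter_comm, Set.Ioc_inter_Iic, Set.inter_comm, Set.Ioc_inter_Iic]
    exact key _ _ (min_le_left _ _) (min_le_left _ _)
  · rw [Measure.restrict_apply_univ, withDensity_apply _ .univ, Measure.restrict_univ]
    exact key _ _ le_rfl le_rfl

/-- Near a point where the mixed derivative of the distribution function is positive, integrals
over small squares are integrals against that derivative. -/
lemma eventually_setIntegral_square_eq {μ : Measure (ℝ × ℝ)} [IsFiniteMeasure μ]
    {G : ℝ × ℝ → ℝ} (hμ : ∀ q, G q = μ.real (Set.Iic q.1 ×ˢ Set.Iic q.2)) {t u : ℝ}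
    (hG : ContDiffAt ℝ 2 G (t, u)) (hpos : 0 < densityOf G (t, u)) :
    ∀ᶠ h in 𝓝[>] (0 : ℝ), ∀ f : ℝ × ℝ → ℝ,
      ∫ z in square t u h, f z ∂μ = ∫ z in square t u h, f z * densityOf G z := by
  have hev : ∀ᶠ z in 𝓝 (t, u), ContDiffAt ℝ 2 G z ∧ 0 < densityOf G z :=
    (hG.eventually (by simp)).and ((continuousAt_densityOf hG).eventually_const_lt hpos)
  obtain ⟨r, hsq, hr⟩ := ((eventually_forall_mem_square hev).and self_mem_nhdsWithin).exists
  have hr0 : (0 : ℝ) < r := hr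
  filter_upwards [Ioo_mem_nhdsGT hr0] with h hh f
  have hcont : ContinuousOn (densityOf G) (square t u r) := fun z hz =>
    (continuousAt_densityOf (hsq z hz).1).continuousWithinAt
  have hres := restrict_eq_withDensity_densityOf hμ (a := t - r) (b := t + r) (c := u - r)
    (d := u + r) (fun z hz => (hsq z hz).1) fun z hz => (hsq z hz).2.le
  set K := Set.Ioc (t - r) (t + r) ×ˢ Set.Ioc (u - r) (u + r)
  have hsK : square t u h ⊆ K := by
    rintro z ⟨⟨h1, h2⟩, h3, h4⟩
    exact ⟨⟨by linarith [hh.2], by linarith [hh.2]⟩, by linarith [hh.2], by linarith [hh.2]⟩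
  have hKs : K ⊆ square t u r := Set.prod_mono Set.Ioc_subset_Icc_self Set.Ioc_subset_Icc_self
  have hms := measurableSet_square t u h
  have hres' : μ.restrict (square t u h) = (volume.restrict (square t u h)).withDensity
        fun z => ENNReal.ofReal (densityOf G z) := by
    have := congrArg (fun m => m.restrict (square t u h)) hres
    simp only [Measure.restrict_restrict hms, Set.inter_eq_left.2 hsK,
      restrict_withDensity hms] at this
    exact this
  have hae : AEMeasurable (fun z => ENNReal.ofReal (densityOf G z))
      (volume.restrict (square t u h)) :=
    ((hcont.mono (hsK.trans hKs)).aemeasurable hms).ennreal_ofReal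
  rw [hres', integral_withDensity_eq_integral_toReal_smul₀ hae
    (ae_of_all _ fun z => ENNReal.ofReal_lt_top)]
  refine setIntegral_congr_fun hms fun z hz => ?_
  rw [ENNReal.toReal_ofReal (hsq z (hKs (hsK hz))).2.le, smul_eq_mul, mul_comm]

/-! ### The plug-in estimator and its summands -/

lemma setIntegral_empiricalMeasure {E : Type*} [MeasurableSpace E] [MeasurableSingletonClass E]
    (n : ℕ) (z : ℕ → E) {A : Set E} (hA : MeasurableSet A) (φ : E → ℝ) :
    ∫ x in A, φ x ∂(empiricalMeasure n z)
      = (n : ℝ)⁻¹ * ∑ i ∈ Finset.range n, A.indicator φ (z i) := by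
  rw [← integral_indicator hA, empiricalMeasure, integral_smul_measure, integral_finsetSum_measure]
  · simp [integral_dirac]
  · exact fun i _ => integrable_dirac (by simp)

/-- The estimator as a ratio of sums; the factors `1 / n` cancel, and for `n = 0` both sides are
`0 / 0`. -/
lemma plugInEstimator_eq_div (n : ℕ) (x y t u : ℕ → ℝ) {A : Set (ℝ × ℝ)} (hA : MeasurableSet A) :
    plugInEstimator n x y t u A =
      (∑ i ∈ Finset.range n, status (x i) (t i) * status (y i) (u i) *
        A.indicator (fun _ => 1) (t i, u i)) /
      ∑ i ∈ Finset.range n, A.indicator (fun _ => (1 : ℝ)) (t i, u i) := by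
  have hA' : MeasurableSet {p : ℝ × ℝ × ℝ × ℝ | (p.1, p.2.1) ∈ A} :=
    (by fun_prop : Measurable fun p : ℝ × ℝ × ℝ × ℝ => (p.1, p.2.1)) hA
  rw [plugInEstimator, empiricalP, empiricalG, setIntegral_empiricalMeasure _ _ hA',
    setIntegral_empiricalMeasure _ _ hA]
  rcases eq_or_ne n 0 with rfl | hn
  · simp
  rw [mul_div_mul_left _ _ (inv_ne_zero (Nat.cast_ne_zero.2 hn))]
  congr 1
  refine Finset.sum_congr rfl fun i _ => ?_
  by_cases h : (t i, u i) ∈ A <;> simp [h]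

lemma status_mul_status (x y t u : ℝ) :
    status x t * status y u = (Set.Iic t ×ˢ Set.Iic u).indicator (fun _ => 1) (x, y) := by
  by_cases h1 : x ≤ t <;> by_cases h2 : y ≤ u <;> simp [status, h1, h2]

lemma measurable_status : Measurable fun p : ℝ × ℝ => status p.1 p.2 :=
  Measurable.ite (measurableSet_le measurable_fst measurable_snd) measurable_const
    measurable_const

lemma status_mul_status_mem (x y t u : ℝ) :
    status x t * status y u = 0 ∨ status x t * status y u = 1 := by
  by_cases h1 : x ≤ t <;> by_cases h2 : y ≤ u <;> simp [status, h1, h2]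

variable {Ω : Type*} [MeasurableSpace Ω] {P : Measure Ω}

lemma jointCDF_eq_map {V W : Ω → ℝ} (hV : Measurable V) (hW : Measurable W) (q : ℝ × ℝ) :
    jointCDF P V W q = (P.map fun ω => (V ω, W ω)).real (Set.Iic q.1 ×ˢ Set.Iic q.2) := by
  rw [map_measureReal_apply (hV.prodMk hW) (measurableSet_Iic.prod measurableSet_Iic)]
  rfl

/-- Conditioning on the observation point `(T, U)`, which is independent of `(X, Y)`, turns the
product of the two statuses into the distribution function of `(X, Y)` at `(T, U)`. -/
lemma integral_status_eq_setIntegral_jointCDF [IsProbabilityMeasure P] {X Y T U : Ω → ℝ}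
    (hX : Measurable X)
    (hY : Measurable Y) (hT : Measurable T) (hU : Measurable U)
    (hindep : IndepFun (fun ω => (X ω, Y ω)) (fun ω => (T ω, U ω)) P)
    {A : Set (ℝ × ℝ)} (hA : MeasurableSet A) (α γ : ℝ) :
    ∫ ω, (status (X ω) (T ω) * status (Y ω) (U ω) * α + γ)
        * A.indicator (fun _ => 1) (T ω, U ω) ∂P
      = ∫ w in A, (jointCDF P X Y w * α + γ) ∂(P.map fun ω => (T ω, U ω)) := by
  have hXY : Measurable fun ω => (X ω, Y ω) := hX.prodMk hY
  have hTU : Measurable fun ω => (T ω, U ω) := hT.prodMk hU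
  have : IsProbabilityMeasure (P.map fun ω => (X ω, Y ω)) :=
    Measure.isProbabilityMeasure_map hXY.aemeasurable
  have : IsProbabilityMeasure (P.map fun ω => (T ω, U ω)) :=
    Measure.isProbabilityMeasure_map hTU.aemeasurable
  have hmap := (indepFun_iff_map_prod_eq_prod_map_map hXY.aemeasurable hTU.aemeasurable).1 hindep
  set ψ : (ℝ × ℝ) × (ℝ × ℝ) → ℝ := fun p =>
    (status p.1.1 p.2.1 * status p.1.2 p.2.2 * α + γ) * A.indicator (fun _ => 1) p.2 with hψ
  have hind : Measurable (A.indicator (fun _ => (1 : ℝ))) := measurable_const.indicator hA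
  have hψm : Measurable ψ := by
    have h1 : Measurable fun p : (ℝ × ℝ) × (ℝ × ℝ) => status p.1.1 p.2.1 :=
      measurable_status.comp (by fun_prop : Measurable fun p : (ℝ × ℝ) × (ℝ × ℝ) => (p.1.1, p.2.1))
    have h2 : Measurable fun p : (ℝ × ℝ) × (ℝ × ℝ) => status p.1.2 p.2.2 :=
      measurable_status.comp (by fun_prop : Measurable fun p : (ℝ × ℝ) × (ℝ × ℝ) => (p.1.2, p.2.2))
    exact (((h1.mul h2).mul_const α).add_const γ).mul (hind.comp measurable_snd)
  have hψb : ∀ p, ‖ψ p‖ ≤ |α| + |γ| := by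
    intro p
    have h1 : |status p.1.1 p.2.1 * status p.1.2 p.2.2 * α + γ| ≤ |α| + |γ| := by
      rcases status_mul_status_mem p.1.1 p.1.2 p.2.1 p.2.2 with h | h
      · rw [h]; simp
      · rw [h, one_mul]; exact abs_add_le _ _
    rw [hψ, Real.norm_eq_abs]
    by_cases hp : p.2 ∈ A
    · simpa [hp] using h1
    · simp only [Set.indicator_of_notMem hp, mul_zero, abs_zero]
      positivity
  have hψi : Integrable ψ ((P.map fun ω => (X ω, Y ω)).prod (P.map fun ω => (T ω, U ω))) :=
    .of_bound hψm.aestronglyMeasurable (|α| + |γ|) (ae_of_all _ hψb)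
  calc _ = ∫ ω, ψ ((X ω, Y ω), (T ω, U ω)) ∂P := rfl
    _ = ∫ p, ψ p ∂((P.map fun ω => (X ω, Y ω)).prod (P.map fun ω => (T ω, U ω))) := by
      rw [← hmap, integral_map (hXY.prodMk hTU).aemeasurable hψm.aestronglyMeasurable]
    _ = ∫ w, (∫ z, ψ (z, w) ∂(P.map fun ω => (X ω, Y ω))) ∂(P.map fun ω => (T ω, U ω)) :=
      integral_prod_symm _ hψi
    _ = _ := by
      rw [← integral_indicator hA]
      refine integral_congr_ae (ae_of_all _ fun w => ?_)
      by_cases hw : w ∈ A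
      · have hms : MeasurableSet (Set.Iic w.1 ×ˢ Set.Iic w.2) :=
          measurableSet_Iic.prod measurableSet_Iic
        simp only [hψ, Set.indicator_of_mem hw, mul_one, status_mul_status, Prod.mk.eta]
        rw [integral_add, integral_mul_const, integral_indicator hms, jointCDF_eq_map hX hY]
        · simp
        · exact ((integrable_const (1 : ℝ)).indicator hms).mul_const α
        · exact integrable_const _
      · simp [hψ, hw]

end BivariateCurrentStatus

/-! ### The limit law -/

open BivariateCurrentStatus in
/-- Asymptotic normality, at rate `n^(1/3)`, of the plug-in estimator in the bivariate current
status model. The vectors `(Xᵢ, Yᵢ, Tᵢ, Uᵢ)` are i.i.d. and `(Xᵢ, Yᵢ)` is independent of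
`(Tᵢ, Uᵢ)`; `F₀` and `G` are the distribution functions of `(Xᵢ, Yᵢ)` and `(Tᵢ, Uᵢ)`. The asymptotic
variance is nonnegative, so that `Real.toNNReal` does not change it; a normal law with variance
zero is a point mass. -/
theorem theorem2p1 {Ω : Type*} [MeasurableSpace Ω] (P : Measure Ω) [IsProbabilityMeasure P]
    (X Y T U : ℕ → Ω → ℝ)
    (hX : ∀ i, Measurable (X i)) (hY : ∀ i, Measurable (Y i))
    (hT : ∀ i, Measurable (T i)) (hU : ∀ i, Measurable (U i))
    (hiid : iIndepFun (fun i ω => (X i ω, Y i ω, T i ω, U i ω)) P)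
    (hident : ∀ i, IdentDistrib (fun ω => (X i ω, Y i ω, T i ω, U i ω))
      (fun ω => (X 0 ω, Y 0 ω, T 0 ω, U 0 ω)) P P)
    (hindep : IndepFun (fun ω => (X 0 ω, Y 0 ω)) (fun ω => (T 0 ω, U 0 ω)) P)
    (F₀ G g : ℝ × ℝ → ℝ)
    (hF₀ : F₀ = BivariateCurrentStatus.jointCDF P (X 0) (Y 0))
    (hG : G = BivariateCurrentStatus.jointCDF P (T 0) (U 0))
    (hg : g = BivariateCurrentStatus.densityOf G)
    (t u : ℝ)
    (hF₀_smooth : ContDiffAt ℝ 2 F₀ (t, u))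
    (hG_smooth : ContDiffAt ℝ 2 G (t, u))
    (hg_diff : DifferentiableAt ℝ g (t, u))
    (hg_pos : 0 < g (t, u))
    (h : ℕ → ℝ) (hh_pos : ∀ᶠ n in atTop, 0 < h n)
    (c : ℝ) (hc : 0 < c)
    (hh : Tendsto (fun n : ℕ => h n ^ 2 * (n : ℝ) ^ (1 / 3 : ℝ)) atTop (𝓝 c)) :
    TendstoInDistribution
      (fun (n : ℕ) (ω : Ω) => (n : ℝ) ^ (1 / 3 : ℝ) *
        (BivariateCurrentStatus.plugInEstimator n (fun i => X i ω) (fun i => Y i ω)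
          (fun i => T i ω) (fun i => U i ω) (BivariateCurrentStatus.square t u (h n)) -
            F₀ (t, u)))
      atTop
      (id : ℝ → ℝ)
      (fun _ => P)
      (gaussianReal (BivariateCurrentStatus.asymptoticMean F₀ g c (t, u))
        (BivariateCurrentStatus.asymptoticVariance F₀ g c (t, u)).toNNReal) := by
  set f₀ := F₀ (t, u) with hf₀
  set g₀ := g (t, u) with hg₀
  set q : ℕ → ℝ := fun n => (n : ℝ) ^ (1 / 3 : ℝ) with hq
  set A : ℕ → Set (ℝ × ℝ) := fun n => square t u (h n)
  have hA : ∀ n, MeasurableSet (A n) := fun n => measurableSet_square t u (h n)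
  -- `m n = 4 n h² g` is asymptotic to the expected number of observation points in the square.
  set m : ℕ → ℝ := fun n => 4 * n * h n ^ 2 * g₀ with hm
  have hm0 : ∀ n, 0 ≤ m n := fun n => by positivity
  have hq0 : ∀ n, 0 ≤ q n := fun n => by positivity
  have hq3 : ∀ n : ℕ, q n ^ 3 = n := fun n => by
    rw [hq, ← Real.rpow_natCast, ← Real.rpow_mul n.cast_nonneg]; norm_num
  have hqtop : Tendsto q atTop atTop :=
    (tendsto_rpow_atTop (by norm_num)).comp tendsto_natCast_atTop_atTop
  have hqinv : Tendsto (fun n => (q n)⁻¹) atTop (𝓝 0) := tendsto_inv_atTop_zero.comp hqtop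
  have hqpos : ∀ᶠ n in atTop, 0 < q n := hqtop.eventually_gt_atTop 0
  have hh2 : Tendsto (fun n => h n ^ 2) atTop (𝓝 0) := by
    have := hh.mul hqinv
    rw [mul_zero] at this
    refine this.congr' ?_
    filter_upwards [hqpos] with n hn
    exact mul_inv_cancel_right₀ hn.ne' _
  have hh0 : Tendsto h atTop (𝓝[>] 0) := by
    refine tendsto_nhdsWithin_iff.2 ⟨?_, hh_pos⟩
    have := (Real.continuous_sqrt.tendsto 0).comp hh2
    rw [Real.sqrt_zero] at this
    refine this.congr' ?_
    filter_upwards [hh_pos] with n hn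
    exact Real.sqrt_sq hn.le
  have hhq : Tendsto (fun n => h n ^ 2 * q n) atTop (𝓝 c) := hh
  have hhinv : Tendsto (fun n => (h n ^ 2 * q n)⁻¹) atTop (𝓝 c⁻¹) := hhq.inv₀ hc.ne'
  have hminv : Tendsto (fun n => (m n)⁻¹) atTop (𝓝 0) := by
    have := ((hhinv.mul hqinv).mul hqinv).const_mul ((4 * g₀)⁻¹)
    simp only [mul_zero] at this
    refine this.congr fun n => ?_
    simp only [hm]
    rw [← hq3 n]
    simp only [← mul_inv]
    congr 1; ring
  have hqm : Tendsto (fun n => q n / m n) atTop (𝓝 0) := by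
    have := (hhinv.mul hqinv).const_mul ((4 * g₀)⁻¹)
    simp only [mul_zero] at this
    refine this.congr' ?_
    filter_upwards [hqpos, hh_pos] with n hn hn'
    simp only [hm]
    rw [← hq3 n]
    field_simp
  -- Integrals over the squares with respect to the law of the observation points.
  have hTU : Measurable fun ω => (T 0 ω, U 0 ω) := (hT 0).prodMk (hU 0)
  set μ := P.map fun ω => (T 0 ω, U 0 ω) with hμ
  have : IsProbabilityMeasure μ := Measure.isProbabilityMeasure_map hTU.aemeasurable
  have hGμ : ∀ z, G z = μ.real (Set.Iic z.1 ×ˢ Set.Iic z.2) := fun z => by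
    rw [hG, jointCDF_eq_map (hT 0) (hU 0)]
  have hdens : ∀ᶠ n in atTop, ∀ f : ℝ × ℝ → ℝ,
      ∫ z in A n, f z ∂μ = ∫ z in A n, f z * g z := by
    rw [hg]
    exact hh0.eventually (eventually_setIntegral_square_eq hGμ hG_smooth (hg ▸ hg_pos))
  have hgc : ∀ᶠ z in 𝓝 (t, u), ContinuousAt g z :=
    (hG_smooth.eventually (by simp)).mono fun z hz => hg ▸ continuousAt_densityOf hz
  have hFc : ∀ᶠ z in 𝓝 (t, u), ContinuousAt F₀ z :=
    (hF₀_smooth.eventually (by simp)).mono fun z hz => hz.continuousAt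
  have hsum : ∀ (α γ : ℝ), Tendsto (fun n => (∫ z in A n, (F₀ z * α + γ) ∂μ) / h n ^ 2) atTop
      (𝓝 (4 * ((f₀ * α + γ) * g₀))) := by
    intro α γ
    have := (tendsto_integral_square_div_sq (f := fun z => (F₀ z * α + γ) * g z)
      (hFc.and hgc |>.mono fun z hz =>
        ((hz.1.mul continuousAt_const).add continuousAt_const).mul hz.2)).comp hh0
    refine this.congr' ?_
    filter_upwards [hdens] with n hn
    rw [hn]; rfl
  obtain ⟨k, hk⟩ := exists_mul_sub_quadPoly_isLittleO hF₀_smooth hg_diff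
  have hbias : Tendsto (fun n => (∫ z in A n, (F₀ z * 1 + -f₀) ∂μ) / h n ^ 4) atTop
      (𝓝 (4 * ((partial₁ (partial₁ F₀) (t, u) / 2 * g₀ + partial₁ F₀ (t, u) * partial₁ g (t, u))
        + (partial₂ (partial₂ F₀) (t, u) / 2 * g₀ + partial₂ F₀ (t, u) * partial₂ g (t, u)))
        / 3)) := by
    have := (tendsto_integral_square_div_pow_four (f := fun z => (F₀ z - F₀ (t, u)) * g z)
      (hFc.and hgc |>.mono fun z hz => (hz.1.sub continuousAt_const).mul hz.2) hk).comp hh0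
    refine this.congr' ?_
    filter_upwards [hdens] with n hn
    rw [hn]
    simp only [mul_one, ← sub_eq_add_neg]
    rfl
  have hmom : ∀ n (α γ : ℝ), ∫ ω, (status (X 0 ω) (T 0 ω) * status (Y 0 ω) (U 0 ω) * α + γ)
        * (A n).indicator (fun _ => 1) (T 0 ω, U 0 ω) ∂P = ∫ z in A n, (F₀ z * α + γ) ∂μ := by
    intro n α γ
    rw [hF₀]
    exact integral_status_eq_setIntegral_jointCDF (hX 0) (hY 0) (hT 0) (hU 0) hindep (hA n) α γ
  -- The two triangular arrays, as functions of the vectors `(X i, Y i, T i, U i)`.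
  set Φ : ℕ → ℝ × ℝ × ℝ × ℝ → ℝ := fun n p => q n / m n *
    ((status p.1 p.2.2.1 * status p.2.1 p.2.2.2 * 1 + -f₀) *
      (A n).indicator (fun _ => 1) p.2.2) with hΦ
  set Ψ : ℕ → ℝ × ℝ × ℝ × ℝ → ℝ := fun n p =>
    (m n)⁻¹ * (A n).indicator (fun _ => 1) p.2.2 with hΨ
  have hindm : ∀ n, Measurable fun p : ℝ × ℝ × ℝ × ℝ =>
      (A n).indicator (fun _ => (1 : ℝ)) p.2.2 := fun n =>
    (measurable_const.indicator (hA n)).comp (by fun_prop)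
  have hs1 : Measurable fun p : ℝ × ℝ × ℝ × ℝ => status p.1 p.2.2.1 :=
    measurable_status.comp (by fun_prop : Measurable fun p : ℝ × ℝ × ℝ × ℝ => (p.1, p.2.2.1))
  have hs2 : Measurable fun p : ℝ × ℝ × ℝ × ℝ => status p.2.1 p.2.2.2 :=
    measurable_status.comp (by fun_prop : Measurable fun p : ℝ × ℝ × ℝ × ℝ => (p.2.1, p.2.2.2))
  have hΦm : ∀ n, Measurable (Φ n) := fun n =>
    ((((hs1.mul hs2).mul_const 1).add_const _).mul (hindm n)).const_mul _
  have hΨm : ∀ n, Measurable (Ψ n) := fun n => (hindm n).const_mul _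
  have hV : ∀ i, Measurable fun ω => (X i ω, Y i ω, T i ω, U i ω) := fun i =>
    (hX i).prodMk ((hY i).prodMk ((hT i).prodMk (hU i)))
  have hf₀01 : 0 ≤ f₀ ∧ f₀ ≤ 1 := by
    rw [hf₀, hF₀]
    exact ⟨measureReal_nonneg, measureReal_le_one⟩
  have hΦb : ∀ n p, |Φ n p| ≤ q n / m n := by
    intro n p
    have h0 : 0 ≤ q n / m n := div_nonneg (hq0 n) (hm0 n)
    rw [hΦ]
    simp only
    rw [abs_mul, abs_of_nonneg h0]
    refine mul_le_of_le_one_right h0 ?_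
    by_cases hp : p.2.2 ∈ A n
    · rw [Set.indicator_of_mem hp, mul_one, abs_le]
      rcases status_mul_status_mem p.1 p.2.1 p.2.2.1 p.2.2.2 with h | h <;> rw [h] <;>
        constructor <;> linarith [hf₀01.1, hf₀01.2]
    · simp [hp]
  have hΨb : ∀ n p, |Ψ n p| ≤ (m n)⁻¹ := by
    intro n p
    have h0 : 0 ≤ (m n)⁻¹ := inv_nonneg.2 (hm0 n)
    by_cases hp : p.2.2 ∈ A n
    · simp [hΨ, hp, abs_of_nonneg (hm0 n)]
    · simpa [hΨ, hp] using h0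
  have hS := tendstoInDistribution_sum_of_tendsto_moments (P := P)
    (ξ := fun n i ω => Φ n (X i ω, Y i ω, T i ω, U i ω))
    (b := fun n => q n / m n) (β := asymptoticMean F₀ g c (t, u))
    (v := asymptoticVariance F₀ g c (t, u))
    (fun n i => (hΦm n).comp (hV i)) (fun n => hiid.comp (fun _ => Φ n) fun _ => hΦm n)
    (fun n i => (hident i).comp (hΦm n)) (fun n i ω => hΦb n _) hqm
    (by
      have := (hhq.mul hbias).const_mul (4 * g₀)⁻¹
      have e : (4 * g₀)⁻¹ * (c * (4 * ((partial₁ (partial₁ F₀) (t, u) / 2 * g₀ +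
          partial₁ F₀ (t, u) * partial₁ g (t, u)) + (partial₂ (partial₂ F₀) (t, u) / 2 * g₀ +
          partial₂ F₀ (t, u) * partial₂ g (t, u))) / 3)) = asymptoticMean F₀ g c (t, u) := by
        simp only [asymptoticMean, ← hg₀]
        field_simp
        ring
      rw [e] at this
      refine this.congr' ?_
      filter_upwards [hqpos, hh_pos] with n hn hn'
      simp only [hΦ]
      rw [integral_const_mul, hmom]
      simp only [hm]
      rw [← hq3 n]
      field_simp)
    (by
      have := (hhinv.mul (hsum (1 - 2 * f₀) (f₀ ^ 2))).const_mul (16 * g₀ ^ 2)⁻¹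
      have e : (16 * g₀ ^ 2)⁻¹ * (c⁻¹ * (4 * ((f₀ * (1 - 2 * f₀) + f₀ ^ 2) * g₀)))
          = asymptoticVariance F₀ g c (t, u) := by
        simp only [asymptoticVariance, ← hg₀, ← hf₀]
        field_simp
        ring
      rw [e] at this
      refine this.congr' ?_
      filter_upwards [hqpos, hh_pos] with n hn hn'
      -- `δ = Δ₁ Δ₂` is `0` or `1`, so `(δ - F₀)² = δ (1 - 2 F₀) + F₀²`.
      have e2 : ∀ ω, Φ n (X 0 ω, Y 0 ω, T 0 ω, U 0 ω) ^ 2 = (q n / m n) ^ 2 *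
          ((status (X 0 ω) (T 0 ω) * status (Y 0 ω) (U 0 ω) * (1 - 2 * f₀) + f₀ ^ 2)
        * (A n).indicator (fun _ => 1) (T 0 ω, U 0 ω)) := by
        intro ω
        simp only [hΦ]
        by_cases hp : (T 0 ω, U 0 ω) ∈ A n
        · rw [Set.indicator_of_mem hp]
          rcases status_mul_status_mem (X 0 ω) (Y 0 ω) (T 0 ω) (U 0 ω) with h | h <;> rw [h] <;>
            ring
        · simp [hp]
      simp only [e2]
      rw [integral_const_mul, hmom]
      simp only [hm]
      rw [← hq3 n]
      generalize (∫ z in A n, (F₀ z * (1 - 2 * f₀) + f₀ ^ 2) ∂μ) = J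
      field_simp
      ring)
  have hcount : Tendsto (fun n : ℕ => (n : ℝ) * ∫ ω, Ψ n (X 0 ω, Y 0 ω, T 0 ω, U 0 ω) ∂P) atTop
      (𝓝 1) := by
    have := (hsum 0 1).const_mul (4 * g₀)⁻¹
    have e : (4 * g₀)⁻¹ * (4 * ((f₀ * 0 + 1) * g₀)) = 1 := by field_simp; ring
    rw [e] at this
    refine this.congr' ?_
    filter_upwards [hqpos, hh_pos] with n hn hn'
    have hn0 : (n : ℝ) ≠ 0 := by rw [← hq3 n]; positivity
    rw [← hmom]
    simp only [hΨ, mul_zero, zero_add, one_mul]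
    rw [integral_const_mul]
    simp only [hm]
    field_simp
  have hW := tendstoInDistribution_sum_of_tendsto_moments (P := P)
    (ξ := fun n i ω => Ψ n (X i ω, Y i ω, T i ω, U i ω))
    (b := fun n => (m n)⁻¹) (β := 1) (v := 0)
    (fun n i => (hΨm n).comp (hV i)) (fun n => hiid.comp (fun _ => Ψ n) fun _ => hΨm n)
    (fun n i => (hident i).comp (hΨm n)) (fun n i ω => hΨb n _) hminv hcount
    (by
      have := hminv.mul hcount
      rw [zero_mul] at this
      refine this.congr fun n => ?_
      have e : ∀ ω, Ψ n (X 0 ω, Y 0 ω, T 0 ω, U 0 ω) ^ 2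
          = (m n)⁻¹ * Ψ n (X 0 ω, Y 0 ω, T 0 ω, U 0 ω) := by
        intro ω
        by_cases hp : (T 0 ω, U 0 ω) ∈ A n <;> simp [hΨ, hp, pow_two]
      simp only [e]
      rw [integral_const_mul (m n)⁻¹ fun ω => Ψ n (X 0 ω, Y 0 ω, T 0 ω, U 0 ω)]
      ring)
  simp only [Real.toNNReal_zero, gaussianReal_zero_var] at hW
  refine hS.of_eq_div (tendstoInMeasure_of_tendstoInDistribution_dirac hW)
    (fun n => Finset.measurable_fun_sum _ fun i _ => (hΨm n).comp (hV i)) (fun n => ?_) ?_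
  · simp only [plugInEstimator_eq_div n _ _ _ _ (measurableSet_square t u (h n))]
    refine (Measurable.sub_const (Measurable.div ?_ ?_) _).const_mul _
    · exact Finset.measurable_fun_sum _ fun i _ =>
        ((hs1.mul hs2).mul (hindm n)).comp (hV i)
    · exact Finset.measurable_fun_sum _ fun i _ => (hindm n).comp (hV i)
  · filter_upwards [hqpos, hh_pos] with n hn hn' ω hω
    have hn0 : (n : ℝ) ≠ 0 := by rw [← hq3 n]; positivity
    have hmn : m n ≠ 0 := by simp only [hm]; positivity
    simp only [hΨ, ← Finset.mul_sum] at hω ⊢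
    have hD := right_ne_zero_of_mul hω
    rw [plugInEstimator_eq_div n _ _ _ _ (measurableSet_square t u (h n))]
    simp only [hΦ, ← Finset.mul_sum, mul_one, add_mul, Finset.sum_add_distrib]
    change q n * (_ - f₀) = _
    rw [eq_div_iff hω]
    change (∑ i ∈ Finset.range n, (square t u (h n)).indicator (fun _ => (1 : ℝ))
      (T i ω, U i ω)) ≠ 0 at hD
    field_simp
    simp only [A]
    ring
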